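/- All groups and graphs are finite. For a group $G$ and a subset $S\subseteq G$, the Haar graph $H(G,S)$ is the graph with vertex set $G\times\{0,1\}$ whose edges join $(g,0)$ to $(sg,1)$ for $g\in G$, $s\in S$. It is called algebraically Cayley if some subgroup of $\mathrm{Aut}\,H(G,S)$ acts regularly on the vertices and contains all the right translations $(x,i)\mapsto(xg,i)$, $g\in G$. A graph is a Cayley graph of a group $A$ if it is isomorphic to $\mathrm{Cay}(A,T)$ for some $T\subseteq A$ with $1\notin T=T^{-1}$, where $\mathrm{Cay}(A,T)$ has vertex set $A$ and edges joining $g$ to $tg$ for $g\in A$, $t\in T$. A group is metacyclic if it has a cyclic normal subgroup with cyclic quotient; it is nonsplit metacyclic if, moreover, it is not a semidirect product $K\rtimes H$ of cyclic groups $K$, $H$ (possibly trivial). Let $p$ be an odd prime, $G$ a nonsplit metacyclic $p$-group of order $p^n$, $N$ a subgroup of $G$ of index $p$, and $x\in G\setminus N$. Then the Haar graph $H(G,N\cup\{x\})$ is a Cayley graph of the group $\mathbb{Z}_{p^{n-1}}\times D_p$, where $D_p$ is the dihedral group of order $2p$, but it is not algebraically Cayley. -/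

import Mathlib

/-- A group is metacyclic if it has a cyclic normal subgroup with cyclic quotient. -/
def IsMetacyclic (G : Type*) [Group G] : Prop :=
  ∃ (K : Subgroup G) (_ : K.Normal), IsCyclic K ∧ IsCyclic (G ⧸ K)

/-- A group is split metacyclic if it is an (internal) semidirect product of two cyclic subgroups:
a cyclic normal subgroup `K` and a cyclic complement `H` of `K`. (Either may be trivial, so that
cyclic groups are split.) -/
def IsSplitMetacyclic (G : Type*) [Group G] : Prop :=
  ∃ K H : Subgroup G, K.Normal ∧ IsCyclic K ∧ IsCyclic H ∧ K.IsComplement' H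

/-- A nonsplit metacyclic group: metacyclic, but not a semidirect product of cyclic groups. -/
def IsNonsplitMetacyclic (G : Type*) [Group G] : Prop :=
  IsMetacyclic G ∧ ¬ IsSplitMetacyclic G

/-- The Haar graph `H(G, S)`: its vertex set is `G × {0, 1}`, and its edges join
`(g, 0)` to `(s * g, 1)` for `g ∈ G` and `s ∈ S`. -/
def haarGraph {G : Type*} [Group G] (S : Set G) : SimpleGraph (G × Fin 2) where
  Adj a b := ∃ g : G, ∃ s ∈ S,
    (a = (g, 0) ∧ b = (s * g, 1)) ∨ (b = (g, 0) ∧ a = (s * g, 1))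
  symm := ⟨by
    rintro a b ⟨g, s, hs, h⟩
    exact ⟨g, s, hs, h.symm⟩⟩
  loopless := ⟨by
    rintro a ⟨g, s, hs, ⟨h, h'⟩ | ⟨h, h'⟩⟩ <;> simp [h] at h'⟩

/-- The Cayley graph `Cay(A, T)`, for `1 ∉ T` and `T = T⁻¹`: its vertex set is `A`, and its edges
join `g` to `t * g` for `g ∈ A` and `t ∈ T`. -/
def cayleyGraph {A : Type*} [Group A] (T : Set A) (h1 : (1 : A) ∉ T) (hT : T⁻¹ = T) :
    SimpleGraph A where
  Adj a b := ∃ t ∈ T, b = t * a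
  symm := ⟨by
    rintro a b ⟨t, ht, rfl⟩
    refine ⟨t⁻¹, ?_, by simp⟩
    rw [← hT]
    exact Set.inv_mem_inv.2 ht⟩
  loopless := ⟨by
    rintro a ⟨t, ht, h⟩
    have : t = 1 := right_eq_mul.1 h
    exact h1 (this ▸ ht)⟩

/-- `X` is a Cayley graph of the group `A`: it is isomorphic to `Cay(A, T)` for some inverse-closed
subset `T` of `A` not containing the identity. -/
def IsCayleyGraphOf {V : Type*} (X : SimpleGraph V) (A : Type*) [Group A] : Prop :=
  ∃ (T : Set A) (h1 : (1 : A) ∉ T) (hT : T⁻¹ = T), Nonempty (X ≃g cayleyGraph T h1 hT)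

/-- A group of automorphisms of a graph acts regularly on the vertices: for all vertices
`v`, `w`, exactly one member of the group takes `v` to `w`. -/
def ActsRegularly {V : Type*} {X : SimpleGraph V} (A : Subgroup (X ≃g X)) : Prop :=
  ∀ v w : V, ∃! φ : X ≃g X, φ ∈ A ∧ φ v = w

/-- The automorphism `(x, i) ↦ (x * g, i)` of the Haar graph `H(G, S)`. -/
def haarRightMul {G : Type*} [Group G] (S : Set G) (g : G) : haarGraph S ≃g haarGraph S where
  toEquiv := (Equiv.mulRight g).prodCongr (Equiv.refl (Fin 2))
  map_rel_iff' := by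
    rintro ⟨x, i⟩ ⟨y, j⟩
    constructor
    · rintro ⟨k, s, hs, h⟩
      refine ⟨k * g⁻¹, s, hs, ?_⟩
      simpa [eq_mul_inv_iff_mul_eq, ← mul_assoc] using h
    · rintro ⟨k, s, hs, h⟩
      refine ⟨k * g, s, hs, ?_⟩
      simpa [← mul_assoc] using h

/-- The Haar graph `H(G, S)` is algebraically Cayley: some group of automorphisms acting regularly
on the vertices contains all right translations `(x, i) ↦ (x * g, i)`, `g ∈ G`. -/
def IsAlgebraicallyCayley {G : Type*} [Group G] (S : Set G) : Prop :=
  ∃ A : Subgroup (haarGraph S ≃g haarGraph S),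
    (∀ g : G, haarRightMul S g ∈ A) ∧ ActsRegularly A

/-! The graph consists of a complete bipartite graph between the two layers of each coset of `N`,
together with the perfect matching of `(g, 0)` with `(x * g, 1)`. Labelling every coset by `ZMod (p
^ (n - 1))`, consistently along the matching, forgets the group structure of `N`; this gives the
Cayley representation.

In an algebraically Cayley graph, a layer-swapping element of the regular group induces an
automorphism `α` of `G` that fixes some `c` and whose square is conjugation by `c⁻¹`. The shape of
`N ∪ {x}` forces `c ∈ N` and `α x ≡ x⁻¹` modulo `N`. Composing `α` with conjugation by a square root
of `c` gives an involution `β`, nontrivial because `p` is odd.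

Such a `β` makes `G` split (`IsPGroup.isSplitMetacyclic_of_involutive`). Let `π` be the projection
onto the cyclic quotient. If `G` is nonabelian, `π * (π ∘ β)` or `π / (π ∘ β)` has cyclic kernel
`M`. In the first case `β` inverts `M` and its fixed points complement `M`. In the second `M` is
central with cyclic quotient, so `G` is abelian, and abelian groups of this kind split. -/

/-! ### Powers and cyclic subgroups in `p`-groups -/

theorem IsPGroup.exists_pow_pow_eq_self {p : ℕ} [Fact p.Prime] {G : Type*} [Group G]
    (hG : IsPGroup p G) {d : ℕ} (hd : p.Coprime d) (g : G) : ∃ m : ℕ, (g ^ d) ^ m = g :=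
  exists_pow_eq_self_of_coprime (hG.orderOf_coprime hd g).symm

theorem IsPGroup.eq_one_of_pow_eq_one {p : ℕ} [Fact p.Prime] {G : Type*} [Group G]
    (hG : IsPGroup p G) {d : ℕ} (hd : p.Coprime d) {g : G} (h : g ^ d = 1) : g = 1 := by
  obtain ⟨m, hm⟩ := hG.exists_pow_pow_eq_self hd g
  rw [← hm, h, one_pow]

/-- In a finite cyclic group, a nontrivial element of exponent `p` generates all such elements. -/
theorem IsCyclic.mem_zpowers_of_pow_prime_eq_one {p : ℕ} [hp : Fact p.Prime] {C : Type*} [Group C]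
    [Finite C] [IsCyclic C] {e z : C} (he : e ^ p = 1) (hz : z ^ p = 1) (hz1 : z ≠ 1) :
    e ∈ Subgroup.zpowers z := by
  classical
  have := Fintype.ofFinite C
  have ho : orderOf z = p := orderOf_eq_prime hz hz1
  have h1 := IsCyclic.card_pow_eq_one_le (α := C) hp.out.pos
  have hsub : (Finset.univ.filter fun a => a ∈ Subgroup.zpowers z) ⊆
      Finset.univ.filter fun a : C => a ^ p = 1 := by
    intro a ha
    simp only [Finset.mem_filter, Finset.mem_univ, true_and] at ha ⊢
    obtain ⟨i, rfl⟩ := Subgroup.mem_zpowers_iff.1 ha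
    rw [← zpow_natCast, zpow_comm, zpow_natCast, hz, one_zpow]
  have hc : (Finset.univ.filter fun a => a ∈ Subgroup.zpowers z).card = p := by
    rw [← ho, ← Nat.card_zpowers, Nat.card_eq_fintype_card]
    exact (Fintype.card_subtype _).symm
  have heq := Finset.eq_of_subset_of_card_le hsub (by rw [hc]; exact h1)
  have : e ∈ Finset.univ.filter fun a : C => a ^ p = 1 := by simpa using he
  rw [← heq] at this
  simpa using this

theorem mul_zpow_pow_eq_of_conj {G : Type*} [Group G] {k h : G} {r : ℕ}
    (hr : h * k * h⁻¹ = k ^ r) (v : ℤ) (m : ℕ) :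
    (k ^ v * h) ^ m = k ^ (v * (∑ i ∈ Finset.range m, (r : ℤ) ^ i)) * h ^ m := by
  have hr' : ∀ w : ℤ, h * k ^ w = k ^ (w * r) * h := by
    intro w
    rw [← mul_inv_eq_iff_eq_mul, ← conj_zpow, hr, mul_comm w, zpow_mul, zpow_natCast]
  induction m with
  | zero => simp
  | succ m ih =>
    rw [pow_succ', ih, mul_assoc, ← mul_assoc h, hr', mul_assoc, ← pow_succ', ← mul_assoc,
      ← zpow_add]
    congr 2
    rw [geom_sum_succ]
    ring

/-- For an odd prime `p`, the `p`-th power of `k ^ v * h`, when `h` normalizes `⟨k⟩`. -/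
theorem IsPGroup.exists_mul_pow_prime_eq {p : ℕ} [hp : Fact p.Prime] (hp2 : p ≠ 2) {G : Type*}
    [Group G] (hG : IsPGroup p G) {k h : G}
    (hk : h * k * h⁻¹ ∈ Subgroup.zpowers k) :
    ∃ s : ℤ, IsCoprime s (p : ℤ) ∧ ∀ v : ℤ, (k ^ v * h) ^ p = k ^ (v * (p * s)) * h ^ p := by
  have hpp : Prime (p : ℤ) := Nat.prime_iff_prime_int.1 hp.out
  obtain ⟨r, hr⟩ : ∃ r : ℕ, h * k * h⁻¹ = k ^ r := by
    classical
    have hf : IsOfFinOrder k := hG.isOfFinOrder hp.out.ne_zero k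
    obtain ⟨r, hr⟩ := (hf.mem_zpowers_iff_mem_range_orderOf.1 hk : _) |> Finset.mem_image.1
    exact ⟨r, hr.2.symm⟩
  by_cases hk1 : k = 1
  · subst hk1
    exact ⟨1, isCoprime_one_left, fun v => by simp⟩
  have hconj : ∀ m : ℕ, h ^ m * k * (h ^ m)⁻¹ = k ^ (r ^ m) := by
    intro m
    induction m with
    | zero => simp
    | succ m ih =>
      rw [pow_succ', mul_inv_rev]
      calc h * h ^ m * k * ((h ^ m)⁻¹ * h⁻¹) = h * (h ^ m * k * (h ^ m)⁻¹) * h⁻¹ := by group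
        _ = _ := by rw [ih, ← conj_pow, hr, ← pow_mul, ← pow_succ']
  -- Some `r ^ p ^ f` is 1 modulo the order of `k`, hence modulo `p`; Frobenius then gives `r ≡ 1`.
  have hmod : (p : ℤ) ∣ (r : ℤ) - 1 := by
    obtain ⟨f, hf⟩ := (isPGroup_iff_pow_pow_eq_one.1 hG) h
    have h1 := hconj (p ^ f)
    rw [hf] at h1
    have h2 : k ^ ((r : ℤ) ^ p ^ f - 1) = 1 := by
      rw [zpow_sub, zpow_one, mul_inv_eq_one]
      have : ((r : ℤ) ^ p ^ f) = ((r ^ p ^ f : ℕ) : ℤ) := by push_cast; rfl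
      rw [this, zpow_natCast, ← h1]; simp
    have h3 : (p : ℤ) ∣ (r : ℤ) ^ p ^ f - 1 :=
      (Int.natCast_dvd_natCast.2 (hG.dvd_orderOf hk1)).trans (orderOf_dvd_iff_zpow_eq_one.2 h2)
    rw [← ZMod.intCast_zmod_eq_zero_iff_dvd] at h3 ⊢
    push_cast at h3 ⊢
    rwa [ZMod.pow_card_pow] at h3
  obtain ⟨b, hb⟩ := hmod
  have hodd := hp.out.odd_of_ne_two hp2
  -- For odd `p` and `r ≡ 1` modulo `p`, the sum of the `r ^ i`, `i < p`, is `p` modulo `p ^ 2`.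
  have hd := odd_sq_dvd_geom_sum₂_sub (R := ℤ) (a := 1) (b := b) hodd
  rw [show (1 : ℤ) + p * b = r by rw [← hb]; ring] at hd
  simp only [one_pow, mul_one] at hd
  obtain ⟨c, hc⟩ := hd
  refine ⟨1 + p * c, ⟨1, -c, by ring⟩, fun v => ?_⟩
  rw [mul_zpow_pow_eq_of_conj hr]
  congr 3
  linear_combination hc

/-- For `p` odd, a subgroup `M` of a finite `p`-group `G` that contains the commutator subgroup is
cyclic when the commutator subgroup is cyclic and contains all elements of order `p` of `M`. -/
theorem IsPGroup.isCyclic_of_commutator_le {p : ℕ} [hp : Fact p.Prime] (hp2 : p ≠ 2) {G : Type*}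
    [Group G] [Finite G] (hG : IsPGroup p G) (hc : IsCyclic (commutator G)) {M : Subgroup G}
    (hM : commutator G ≤ M) (h : ∀ e ∈ M, e ^ p = 1 → e ∈ commutator G) : IsCyclic M := by
  obtain ⟨L, -, hL⟩ := (Set.toFinite {L : Subgroup G | commutator G ≤ L ∧ L ≤ M ∧ IsCyclic L})
    |>.exists_le_maximal ⟨le_rfl, hM, hc⟩
  obtain ⟨hL1, hL2, hL3⟩ := hL.prop
  suffices M ≤ L by rwa [le_antisymm this hL2]
  by_contra hlt
  obtain ⟨g₀, hg₀M, hg₀L⟩ := SetLike.not_le_iff_exists.1 hlt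
  obtain ⟨g, hgM, hgL, hgp⟩ : ∃ g ∈ M, g ∉ L ∧ g ^ p ∈ L := by
    classical
    have hex : ∃ j, g₀ ^ p ^ j ∈ L := by
      obtain ⟨j, hj⟩ := (isPGroup_iff_pow_pow_eq_one.1 hG) g₀
      exact ⟨j, hj ▸ L.one_mem⟩
    obtain ⟨j, hj⟩ : ∃ j, Nat.find hex = j + 1 := by
      refine Nat.exists_eq_succ_of_ne_zero fun h0 => hg₀L ?_
      have := Nat.find_spec hex
      rwa [h0, pow_zero, pow_one] at this
    refine ⟨g₀ ^ p ^ j, M.pow_mem hg₀M _, Nat.find_min hex (by omega), ?_⟩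
    rw [← pow_mul, ← pow_succ, ← hj]
    exact Nat.find_spec hex
  obtain ⟨k, rfl⟩ := L.isCyclic_iff_exists_zpowers_eq_top.1 hL3
  have hn := Subgroup.Normal.of_commutator_le G hL1
  obtain ⟨w, hw⟩ := Subgroup.mem_zpowers_iff.1 hgp
  obtain ⟨m, hm⟩ := (isPGroup_iff_pow_pow_eq_one.1 hG) k
  by_cases hpw : (p : ℤ) ∣ w
  · obtain ⟨w, rfl⟩ := hpw
    obtain ⟨s, hs, hf⟩ := hG.exists_mul_pow_prime_eq hp2
      (hn.conj_mem k (Subgroup.mem_zpowers k) g)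
    obtain ⟨a, b, hab⟩ : IsCoprime s ((p : ℤ) ^ m) := hs.pow_right
    -- As `a` inverts `s` modulo `p ^ m`, this multiplier cancels `g ^ p = k ^ (p * w)`.
    have he : (k ^ (-w * a) * g) ^ p = 1 := by
      rw [hf, ← hw, ← zpow_add]
      have : -w * a * (p * s) + p * w = (p : ℤ) ^ m * (b * w * p) := by
        linear_combination (-p * w) * hab
      rw [this, zpow_mul]
      have : k ^ ((p : ℤ) ^ m) = 1 := by exact_mod_cast hm
      rw [this, one_zpow]
    have := hL1 (h _ (M.mul_mem (hL2 (Subgroup.zpow_mem_zpowers k _)) hgM) he)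
    exact hgL ((Subgroup.mul_mem_cancel_left _ (Subgroup.zpow_mem_zpowers k _)).1 this)
  · have hcop : IsCoprime w ((p : ℤ) ^ m) :=
      (((Nat.prime_iff_prime_int.1 hp.out).coprime_iff_not_dvd.2 hpw).symm).pow_right
    obtain ⟨a, b, hab⟩ := hcop
    have hkg : k ∈ Subgroup.zpowers g := by
      have : k = (g ^ p) ^ a := by
        rw [← hw, ← zpow_mul, mul_comm w, eq_sub_of_add_eq hab, zpow_sub, mul_comm b, zpow_mul]
        have : k ^ ((p : ℤ) ^ m) = 1 := by exact_mod_cast hm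
        rw [this, one_zpow]; simp
      rw [this]
      exact Subgroup.zpow_mem _ (Subgroup.pow_mem _ (Subgroup.mem_zpowers g) _) _
    have hle : Subgroup.zpowers k ≤ Subgroup.zpowers g := by simpa using hkg
    exact hgL (hL.le_of_ge ⟨hL1.trans hle, by simpa using hgM, inferInstance⟩ hle
      (Subgroup.mem_zpowers g))

/-- An involutive endomorphism leaving a cyclic subgroup invariant acts on it trivially or by
inversion. -/
theorem IsPGroup.involutive_on_isCyclic {p : ℕ} [hp : Fact p.Prime] (hp2 : p ≠ 2) {G : Type*}
    [Group G] (hG : IsPGroup p G) {β : G →* G} (hβ : ∀ g, β (β g) = g)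
    {M : Subgroup G} (hM : IsCyclic M) (hinv : ∀ m ∈ M, β m ∈ M) :
    (∀ m ∈ M, β m = m) ∨ ∀ m ∈ M, β m = m⁻¹ := by
  have hpp : Prime (p : ℤ) := Nat.prime_iff_prime_int.1 hp.out
  obtain ⟨k, rfl⟩ := M.isCyclic_iff_exists_zpowers_eq_top.1 hM
  obtain ⟨r, hr⟩ := Subgroup.mem_zpowers_iff.1 (hinv k (Subgroup.mem_zpowers k))
  obtain ⟨e, he⟩ := (IsPGroup.iff_orderOf.1 hG) k
  -- An odd `p` divides at most one factor, so the other absorbs all of `p ^ e`.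
  have h1 : (p : ℤ) ^ e ∣ (r - 1) * (r + 1) := by
    have : k ^ ((r - 1) * (r + 1)) = 1 := by
      have h2 : k ^ (r * r) = k := by
        rw [zpow_mul, hr, ← map_zpow, hr, hβ]
      rw [show (r - 1) * (r + 1) = r * r - 1 by ring, zpow_sub, h2]; simp
    have := orderOf_dvd_iff_zpow_eq_one.2 this
    rw [he] at this
    exact_mod_cast this
  have hk : ∀ w : ℤ, (p : ℤ) ^ e ∣ w → k ^ w = 1 := by
    intro w hw
    rw [← orderOf_dvd_iff_zpow_eq_one, he]
    exact_mod_cast hw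
  by_cases hd : (p : ℤ) ∣ r - 1
  · have hd' : ¬ (p : ℤ) ∣ r + 1 := by
      intro h2
      have h3 : (p : ℤ) ∣ 2 := by
        have := dvd_sub h2 hd
        rwa [show r + 1 - (r - 1) = 2 by ring] at this
      have h4 : p ∣ 2 := by exact_mod_cast h3
      exact hp2 ((Nat.prime_dvd_prime_iff_eq hp.out Nat.prime_two).1 h4)
    have h2 := hk _ ((hpp.coprime_iff_not_dvd.2 hd').pow_left.dvd_of_dvd_mul_right h1)
    left
    rintro m ⟨j, rfl⟩
    simp only [map_zpow, ← hr]
    rw [zpow_sub, zpow_one, mul_inv_eq_one] at h2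
    rw [h2]
  · have h2 := hk _ ((hpp.coprime_iff_not_dvd.2 hd).pow_left.dvd_of_dvd_mul_left h1)
    right
    rintro m ⟨j, rfl⟩
    simp only [map_zpow, ← hr]
    rw [zpow_add, zpow_one, mul_eq_one_iff_eq_inv] at h2
    rw [h2, inv_zpow]

/-! ### Abelian `p`-groups with two generators -/

open scoped commutatorElement

/-- With `c` inverse to `i` modulo the order of `a`, `a * b ^ (j * c) = (a ^ i * b ^ j) ^ c` is
killed by `p ^ s`, while `a` is not. -/
theorem IsPGroup.exists_orderOf_mul_zpow_lt {p : ℕ} [hp : Fact p.Prime] {G : Type*} [CommGroup G]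
    (hG : IsPGroup p G) {a b : G} {s : ℕ} {i j : ℤ} (hi : ¬ (p : ℤ) ∣ i)
    (hij : a ^ ((p : ℤ) ^ s * i) * b ^ ((p : ℤ) ^ s * j) = 1) (ha : a ^ ((p : ℤ) ^ s * i) ≠ 1) :
    ∃ u : ℤ, orderOf (a * b ^ u) < orderOf a := by
  obtain ⟨e, he⟩ := (IsPGroup.iff_orderOf.1 hG) a
  obtain ⟨c, d, hcd⟩ : IsCoprime i ((p : ℤ) ^ e) :=
    (((Nat.prime_iff_prime_int.1 hp.out).coprime_iff_not_dvd.2 hi).symm).pow_right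
  have hae : a ^ ((p : ℤ) ^ e) = 1 := by
    have := pow_orderOf_eq_one a
    rw [he] at this
    exact_mod_cast this
  have hac : a ^ (i * c) = a := by
    rw [show i * c = 1 - (p : ℤ) ^ e * d by linear_combination hcd, zpow_sub, zpow_mul a _ d, hae]
    simp
  refine ⟨j * c, ?_⟩
  have h1 : (a * b ^ (j * c)) ^ p ^ s = 1 := by
    have : a * b ^ (j * c) = (a ^ i * b ^ j) ^ c := by
      rw [mul_zpow, ← zpow_mul, ← zpow_mul, hac]
    rw [this, ← zpow_natCast, ← zpow_mul, mul_comm c, zpow_mul, mul_zpow, ← zpow_mul, ← zpow_mul]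
    push_cast
    rw [mul_comm i, mul_comm j, hij, one_zpow]
  have hes : s < e := by
    by_contra hle
    apply ha
    obtain ⟨f, rfl⟩ := Nat.exists_eq_add_of_le (not_lt.1 hle)
    rw [pow_add, mul_assoc, zpow_mul, hae, one_zpow]
  rw [he]
  exact (Nat.le_of_dvd (pow_pos hp.out.pos _) (orderOf_dvd_of_pow_eq_one h1)).trans_lt
    (Nat.pow_lt_pow_right hp.out.one_lt hes)

/-- Descent on the sum of the two orders: in a nontrivial relation, the generator whose exponent has
the smaller `p`-part can be replaced by one of lower order. Without such a relation the two cyclic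
groups are complements. -/
theorem IsPGroup.isSplitMetacyclic_of_two_generators {p : ℕ} [hp : Fact p.Prime] {G : Type*}
    [CommGroup G] (hG : IsPGroup p G) (a b : G) (h : ∀ g : G, ∃ i j : ℤ, g = a ^ i * b ^ j) :
    IsSplitMetacyclic G := by
  induction hN : orderOf a + orderOf b using Nat.strong_induction_on generalizing a b with
  | _ N ih =>
  have hstep : ∀ u : ℤ, ∀ g : G, ∃ i j : ℤ, g = (a * b ^ u) ^ i * b ^ j := by
    intro u g
    obtain ⟨i, j, rfl⟩ := h g
    refine ⟨i, j - u * i, ?_⟩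
    rw [mul_zpow, mul_assoc, ← zpow_mul, ← zpow_add]
    congr 2; ring
  have hstep' : ∀ u : ℤ, ∀ g : G, ∃ i j : ℤ, g = (b * a ^ u) ^ i * a ^ j := by
    intro u g
    obtain ⟨i, j, rfl⟩ := h g
    refine ⟨j, i - u * j, ?_⟩
    rw [mul_zpow, mul_assoc, ← zpow_mul, ← zpow_add, mul_comm]
    congr 2; ring
  by_cases hrel : ∃ i j : ℤ, a ^ i * b ^ j = 1 ∧ a ^ i ≠ 1
  · obtain ⟨i, j, hij, hi1⟩ := hrel
    have hj1 : b ^ j ≠ 1 := fun h1 => hi1 (by simpa [h1] using hij)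
    have hi0 : i ≠ 0 := by rintro rfl; simp at hi1
    have hj0 : j ≠ 0 := by rintro rfl; simp at hj1
    have hfin : ∀ z : ℤ, z ≠ 0 → FiniteMultiplicity (p : ℤ) z := fun z hz =>
      Int.finiteMultiplicity_iff.2 ⟨by simpa using hp.out.ne_one, hz⟩
    obtain ⟨i', hi', hpi⟩ := (hfin i hi0).exists_eq_pow_mul_and_not_dvd
    obtain ⟨j', hj', hpj⟩ := (hfin j hj0).exists_eq_pow_mul_and_not_dvd
    generalize multiplicity (p : ℤ) i = s at hi'
    generalize multiplicity (p : ℤ) j = t at hj'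
    subst hi' hj'
    rcases le_total s t with hst | hst
    · obtain ⟨f, rfl⟩ := Nat.exists_eq_add_of_le hst
      rw [pow_add, mul_assoc] at hij
      obtain ⟨u, hu⟩ := hG.exists_orderOf_mul_zpow_lt hpi hij hi1
      exact ih _ (by omega) (a * b ^ u) b (hstep u) rfl
    · obtain ⟨f, rfl⟩ := Nat.exists_eq_add_of_le hst
      rw [pow_add, mul_assoc, mul_comm] at hij
      obtain ⟨u, hu⟩ := hG.exists_orderOf_mul_zpow_lt hpj hij hj1
      exact ih _ (by omega) (b * a ^ u) a (hstep' u) rfl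
  · push Not at hrel
    refine ⟨Subgroup.zpowers a, Subgroup.zpowers b, inferInstance, inferInstance, inferInstance,
      Subgroup.isComplement'_of_disjoint_and_mul_eq_univ ?_ ?_⟩
    · rw [Subgroup.disjoint_def]
      rintro _ ⟨i, rfl⟩ ⟨j, hj⟩
      simp only at hj ⊢
      exact hrel i (-j) (by rw [zpow_neg, hj, mul_inv_cancel])
    · rw [Set.eq_univ_iff_forall]
      intro g
      obtain ⟨i, j, rfl⟩ := h g
      exact Set.mul_mem_mul ⟨i, rfl⟩ ⟨j, rfl⟩

/-- An abelian `p`-group that is an extension of a cyclic group by a cyclic group is split. -/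
theorem IsPGroup.isSplitMetacyclic_of_commute {p : ℕ} [hp : Fact p.Prime] {G Q : Type*} [Group G]
    [CommGroup Q] [IsCyclic Q] (hG : IsPGroup p G) (hcomm : ∀ a b : G, a * b = b * a) (π : G →* Q)
    (hK : IsCyclic π.ker) : IsSplitMetacyclic G := by
  let _ : CommGroup G := { ‹Group G› with mul_comm := hcomm }
  obtain ⟨k, hk⟩ := (Subgroup.isCyclic_iff_exists_zpowers_eq_top _).1 hK
  obtain ⟨⟨q, h, rfl⟩, hh⟩ := IsCyclic.exists_generator (α := π.range)
  refine hG.isSplitMetacyclic_of_two_generators k h fun g => ?_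
  obtain ⟨j, hj⟩ := Subgroup.mem_zpowers_iff.1 (hh ⟨π g, g, rfl⟩)
  have hj' : π h ^ j = π g := congrArg Subtype.val hj
  have : g * (h ^ j)⁻¹ ∈ π.ker := by
    rw [MonoidHom.mem_ker, map_mul, map_inv, map_zpow, hj', mul_inv_cancel]
  rw [← hk] at this
  obtain ⟨i, hi⟩ := Subgroup.mem_zpowers_iff.1 this
  exact ⟨i, j, by rw [hi]; group⟩

/-! ### Involutions of metacyclic `p`-groups -/

/-- Let `π` be a homomorphism with cyclic kernel from a nonabelian `p`-group, `p` odd, to a cyclic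
group. For every endomorphism `β`, one of `π * (π ∘ β)` and `π / (π ∘ β)` has cyclic kernel. -/
theorem IsPGroup.isCyclic_ker_mul_or_div {p : ℕ} [hp : Fact p.Prime] (hp2 : p ≠ 2)
    {G Q : Type*} [Group G] [Finite G] [CommGroup Q] [IsCyclic Q] [Finite Q] (hG : IsPGroup p G)
    (π : G →* Q) (hK : IsCyclic π.ker) (hne : commutator G ≠ ⊥) (β : G →* G) :
    IsCyclic (π * π.comp β).ker ∨ IsCyclic (π / π.comp β).ker := by
  have hWK : commutator G ≤ π.ker := Abelianization.commutator_subset_ker π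
  have hcW : IsCyclic (commutator G) :=
    isCyclic_of_injective (Subgroup.inclusion hWK) (Subgroup.inclusion_injective hWK)
  obtain ⟨z, hzW, hzp, hz1⟩ : ∃ z ∈ commutator G, z ^ p = 1 ∧ z ≠ 1 := by
    have : Nontrivial (commutator G) := (Subgroup.nontrivial_iff_ne_bot _).2 hne
    have hd : p ∣ Nat.card (commutator G) := by
      obtain ⟨n, hn, hc⟩ := (hG.to_subgroup (commutator G)).nontrivial_iff_card.1 this
      rw [hc]; exact dvd_pow_self _ hn.ne'
    obtain ⟨z, hz⟩ := exists_prime_orderOf_dvd_card' p hd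
    refine ⟨z, z.2, ?_, ?_⟩
    · rw [← SubmonoidClass.coe_pow, ← hz, pow_orderOf_eq_one, OneMemClass.coe_one]
    · rintro h
      rw [OneMemClass.coe_eq_one] at h
      rw [h, orderOf_one] at hz
      exact hp.out.one_lt.ne hz
  have hKW : ∀ y ∈ π.ker, y ^ p = 1 → y ∈ commutator G := by
    intro y hy hyp
    obtain ⟨i, hi⟩ := Subgroup.mem_zpowers_iff.1 (IsCyclic.mem_zpowers_of_pow_prime_eq_one
      (C := π.ker) (e := ⟨y, hy⟩) (z := ⟨z, hWK hzW⟩) (Subtype.ext hyp) (Subtype.ext hzp)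
      (fun h => hz1 (congrArg Subtype.val h)))
    have : z ^ i = y := congrArg Subtype.val hi
    exact this ▸ Subgroup.zpow_mem _ hzW i
  by_contra hcon
  rw [not_or] at hcon
  obtain ⟨h1, h2⟩ := hcon
  have hex : ∀ χ : G →* Q, ¬ IsCyclic χ.ker → ∃ e ∈ χ.ker, e ^ p = 1 ∧ e ∉ π.ker := by
    intro χ hχ
    by_contra! hno
    exact hχ (hG.isCyclic_of_commutator_le hp2 hcW (Abelianization.commutator_subset_ker χ)
      fun e he hep => hKW e (hno e he hep) hep)
  obtain ⟨e, he, hep, heK⟩ := hex _ h1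
  obtain ⟨f, hf, hfp, hfK⟩ := hex _ h2
  obtain ⟨j, hj⟩ := Subgroup.mem_zpowers_iff.1 (IsCyclic.mem_zpowers_of_pow_prime_eq_one
    (p := p) (e := π e) (z := π f) (by rw [← map_pow, hep, map_one])
    (by rw [← map_pow, hfp, map_one]) hfK)
  have hyK : e * (f ^ j)⁻¹ ∈ π.ker := by
    rw [MonoidHom.mem_ker, map_mul, map_inv, map_zpow, hj, mul_inv_cancel]
  have hfjp : (f ^ j) ^ p = 1 := by
    rw [← zpow_natCast, zpow_comm, zpow_natCast, hfp, one_zpow]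
  -- Apply the `p`-th power formula to `e = k ^ v * f ^ j`: it gives `k ^ (v * (p * s)) = 1`, and
  -- `s` is invertible modulo `p ^ m`.
  have hyp : (e * (f ^ j)⁻¹) ^ p = 1 := by
    obtain ⟨k, hk⟩ := (Subgroup.isCyclic_iff_exists_zpowers_eq_top _).1 hK
    have hn : π.ker.Normal := inferInstance
    have hkm : k ∈ π.ker := hk ▸ Subgroup.mem_zpowers k
    obtain ⟨s, ⟨a, b, hab⟩, hs⟩ := hG.exists_mul_pow_prime_eq hp2 (k := k) (h := f ^ j)
      (by rw [hk]; exact hn.conj_mem k hkm _)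
    rw [← hk] at hyK
    obtain ⟨v, hv⟩ := Subgroup.mem_zpowers_iff.1 hyK
    obtain ⟨m, hm⟩ := (isPGroup_iff_pow_pow_eq_one.1 hG) k
    have h3 := hs v
    rw [hv, inv_mul_cancel_right, hep, hfjp, mul_one] at h3
    rw [← hv]
    have hmp : k ^ ((p : ℤ) ^ m) = 1 := by exact_mod_cast hm
    obtain ⟨a', b', hab'⟩ : IsCoprime s ((p : ℤ) ^ m) := (show IsCoprime s (p : ℤ) from
      ⟨a, b, hab⟩).pow_right
    have : (k ^ v) ^ p = k ^ (v * (p * s) * a' + (p : ℤ) ^ m * (b' * v * p)) := by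
      rw [← zpow_natCast, ← zpow_mul]
      congr 1
      linear_combination (-v * p) * hab'
    rw [this, zpow_add, zpow_mul, ← h3, zpow_mul k ((p : ℤ) ^ m), hmp]
    simp
  have hyW := hKW _ hyK hyp
  -- Now `e` lies in both kernels, so `π e` has square 1 as well as `p`-th power 1.
  have heM : e ∈ (π / π.comp β).ker := by
    have := Subgroup.mul_mem _ (Abelianization.commutator_subset_ker (π / π.comp β) hyW)
      (Subgroup.zpow_mem _ hf j)
    rwa [inv_mul_cancel_right] at this
  apply heK
  rw [MonoidHom.mem_ker] at he heM ⊢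
  simp only [MonoidHom.mul_apply, MonoidHom.div_apply, MonoidHom.comp_apply] at he heM
  have h4 : π e ^ 2 = 1 := by
    rw [div_eq_one] at heM
    rw [pow_two]; nth_rewrite 2 [heM]; exact he
  have h5 : π e ^ p = 1 := by rw [← map_pow, hep, map_one]
  have := pow_gcd_eq_one.2 ⟨h4, h5⟩
  rwa [(Nat.coprime_primes Nat.prime_two hp.out).2 hp2.symm, pow_one] at this

/-- For an odd prime `p`, a metacyclic `p`-group with an automorphism of order two is split. -/
theorem IsPGroup.isSplitMetacyclic_of_involutive {p : ℕ} [hp : Fact p.Prime] (hp2 : p ≠ 2)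
    {G Q : Type*} [Group G] [Finite G] [CommGroup Q] [IsCyclic Q] [Finite Q] (hG : IsPGroup p G)
    (π : G →* Q) (hK : IsCyclic π.ker) {β : G →* G} (hβ : ∀ g, β (β g) = g)
    (hβ1 : ∃ g, β g ≠ g) : IsSplitMetacyclic G := by
  by_cases hne : commutator G = ⊥
  · refine hG.isSplitMetacyclic_of_commute (fun a b => ?_) π hK
    have : ⁅a, b⁆ ∈ commutator G :=
      Subgroup.commutator_mem_commutator (Subgroup.mem_top a) (Subgroup.mem_top b)
    rwa [hne, Subgroup.mem_bot, commutatorElement_eq_one_iff_mul_comm] at this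
  have hco : p.Coprime 2 := (Nat.coprime_primes hp.out Nat.prime_two).2 hp2
  have hsq : ∀ g : G, g ^ 2 = 1 → g = 1 := fun g => hG.eq_one_of_pow_eq_one hco
  rcases hG.isCyclic_ker_mul_or_div hp2 π hK hne β with hM | hM
  · -- the quotient by the kernel is fixed
    have hmem : ∀ g, g⁻¹ * β g ∈ (π * π.comp β).ker := by
      intro g
      simp only [MonoidHom.mem_ker, MonoidHom.mul_apply, MonoidHom.comp_apply, map_mul, map_inv, hβ]
      rw [mul_comm (π (β g)), inv_mul_cancel]
    have hinv : ∀ m ∈ (π * π.comp β).ker, β m ∈ (π * π.comp β).ker := fun m hm => by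
      simpa using Subgroup.mul_mem _ hm (hmem m)
    rcases hG.involutive_on_isCyclic hp2 hβ hM hinv with hid | hneg
    · obtain ⟨g, hg⟩ := hβ1
      refine absurd ?_ hg
      have h1 := hid _ (hmem g)
      rw [map_mul, map_inv, hβ] at h1
      have h2 : (g⁻¹ * β g) ^ 2 = 1 := by
        rw [pow_two]; nth_rewrite 1 [← h1]; group
      exact (inv_mul_eq_one.1 (hsq _ h2)).symm
    · let H : Subgroup G := β.eqLocus (MonoidHom.id G)
      have hH : ∀ g, g ∈ H ↔ β g = g := fun g => Iff.rfl
      have hdisj : Disjoint (π * π.comp β).ker H := by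
        rw [Subgroup.disjoint_def]
        intro m hm hmH
        apply hsq
        have h1 := hneg m hm
        rw [(hH m).1 hmH] at h1
        rw [pow_two]; nth_rewrite 1 [h1]; group
      refine ⟨(π * π.comp β).ker, H, inferInstance, hM, ?_,
        Subgroup.isComplement'_of_disjoint_and_mul_eq_univ hdisj ?_⟩
      · refine isCyclic_of_injective ((π * π.comp β).comp H.subtype) ?_
        rw [injective_iff_map_eq_one]
        intro h hh
        exact Subtype.ext (Subgroup.disjoint_def.1 hdisj hh h.2)
      · rw [Set.eq_univ_iff_forall]
        intro g
        -- A square root `u` of `g⁻¹ * β g` in the kernel is inverted by `β`, so `g * u` is fixed.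
        obtain ⟨m, hm⟩ := hG.exists_pow_pow_eq_self hco (g⁻¹ * β g)
        have hu : (g⁻¹ * β g) ^ m ∈ (π * π.comp β).ker := Subgroup.pow_mem _ (hmem g) m
        have hgH : g * (g⁻¹ * β g) ^ m ∈ H := by
          rw [hH, map_mul, hneg _ hu]
          have : β g = g * ((g⁻¹ * β g) ^ m) ^ 2 := by
            rw [← pow_mul, mul_comm m, pow_mul, hm]; group
          generalize (g⁻¹ * β g) ^ m = u at this
          rw [this]; group
        have hn : (π * π.comp β).ker.Normal := inferInstance
        refine Set.mem_mul.2 ⟨_, hn.conj_mem _ (Subgroup.inv_mem _ hu) g, _, hgH, ?_⟩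
        group
  · -- the quotient by the kernel is inverted
    have hmem : ∀ g, g * β g ∈ (π / π.comp β).ker := by
      intro g
      simp only [MonoidHom.mem_ker, MonoidHom.div_apply, MonoidHom.comp_apply, map_mul, hβ]
      rw [div_mul_div_cancel, div_self']
    have hinv : ∀ m ∈ (π / π.comp β).ker, β m ∈ (π / π.comp β).ker := fun m hm => by
      simpa using Subgroup.mul_mem _ (Subgroup.inv_mem _ hm) (hmem m)
    have hn : (π / π.comp β).ker.Normal := inferInstance
    have hMc : ∀ a ∈ (π / π.comp β).ker, ∀ b ∈ (π / π.comp β).ker, a * b = b * a := by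
      obtain ⟨k, hk⟩ := (Subgroup.isCyclic_iff_exists_zpowers_eq_top _).1 hM
      rw [← hk]
      rintro _ ⟨i, rfl⟩ _ ⟨j, rfl⟩
      exact zpow_mul_comm k i j
    have hcent : (π / π.comp β).ker ≤ Subgroup.center G := by
      intro m hm
      rw [Subgroup.mem_center_iff]
      intro g
      have h1 : β (g * m * g⁻¹) = β g * β m * (β g)⁻¹ := by simp
      -- Both identity and inversion commute with conjugation. Since `g * β g` also centralizes `m`,
      -- so does `g ^ 2`, and `g` is a power of `g ^ 2`.
      have h2 : g * m * g⁻¹ = β g * m * (β g)⁻¹ := by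
        rcases hG.involutive_on_isCyclic hp2 hβ hM hinv with hid | hneg
        · rwa [hid _ hm, hid _ (hn.conj_mem m hm g)] at h1
        · rw [hneg _ hm, hneg _ (hn.conj_mem m hm g)] at h1
          have := congrArg (·⁻¹) h1
          simpa [mul_assoc] using this
      have h3 := hMc _ (hmem g) m hm
      have h4 : g ^ 2 * m = m * g ^ 2 := calc
        g ^ 2 * m = g * (g * m * g⁻¹) * g := by rw [pow_two]; group
        _ = g * β g * m * (β g)⁻¹ * g := by rw [h2]; group
        _ = m * g ^ 2 := by rw [h3, pow_two]; group
      obtain ⟨j, hj⟩ := hG.exists_pow_pow_eq_self hco g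
      have h5 : Commute (g ^ 2) m := h4
      have := h5.pow_left j
      rwa [hj] at this
    exact hG.isSplitMetacyclic_of_commute (isMulCommutative_iff.1
      ((π / π.comp β).isMulCommutative_of_isCyclic_of_ker_le_center hcent)) π hK

/-! ### Automorphisms and Cayley representations of Haar graphs -/

section HaarGraph

variable {G : Type*} [Group G]

@[simp]
theorem haarGraph_adj_zero_one {S : Set G} {g h : G} :
    (haarGraph S).Adj (g, 0) (h, 1) ↔ h * g⁻¹ ∈ S := by
  constructor
  · rintro ⟨k, s, hs, ⟨h1, h2⟩ | ⟨h1, h2⟩⟩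
    · simp only [Prod.mk.injEq, and_true] at h1 h2
      rw [h1, h2]; simpa using hs
    · simp at h1
  · intro hs
    exact ⟨g, _, hs, Or.inl ⟨rfl, by simp⟩⟩

theorem haarGraph_not_adj_same {S : Set G} {g h : G} {i : Fin 2} :
    ¬ (haarGraph S).Adj (g, i) (h, i) := by
  rintro ⟨k, s, hs, ⟨h1, h2⟩ | ⟨h1, h2⟩⟩ <;> simp only [Prod.mk.injEq] at h1 h2 <;>
    exact absurd (h1.2.symm.trans h2.2) (by decide)

@[simp]
theorem haarRightMul_apply {S : Set G} (g x : G) (i : Fin 2) :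
    haarRightMul S g (x, i) = (x * g, i) := rfl

/-- A regular group of automorphisms containing the right translations yields an automorphism of
the group that carries `S` to a translate of `S⁻¹`. -/
theorem IsAlgebraicallyCayley.exists_monoidHom {S : Set G} (h : IsAlgebraicallyCayley S) :
    ∃ (α : G →* G) (c : G), Function.Injective α ∧ α c = c ∧ (∀ g, c * α (α g) = g * c) ∧
      ∀ s ∈ S, (c * α s)⁻¹ ∈ S := by
  obtain ⟨A, hR, hA⟩ := h
  have huniq : ∀ φ ∈ A, ∀ ψ ∈ A, ∀ v, φ v = ψ v → φ = ψ := fun φ hφ ψ hψ v hv =>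
    (hA v (ψ v)).unique ⟨hφ, hv⟩ ⟨hψ, rfl⟩
  obtain ⟨σ, ⟨hσ, hσ1⟩, -⟩ := hA (1, 0) (1, 1)
  -- By regularity, preserving the layer of one vertex would make `σ` a right translation.
  have hswap : ∀ g i, (σ (g, i)).2 ≠ i := by
    intro g i hi
    have heq : σ = haarRightMul S (g⁻¹ * (σ (g, i)).1) :=
      huniq σ hσ _ (hR _) (g, i) (by ext <;> simp [hi])
    rw [heq] at hσ1
    simp at hσ1
  have h0 : ∀ g, σ (g, 0) = ((σ (g, 0)).1, 1) := fun g => by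
    have := hswap g 0
    ext
    · rfl
    · simp only; omega
  have h1 : ∀ g, σ (g, 1) = ((σ (g, 1)).1, 0) := fun g => by
    have := hswap g 1
    ext
    · rfl
    · simp only; omega
  have hcomm : ∀ g, σ * haarRightMul S g = haarRightMul S (σ (g, 0)).1 * σ := fun g =>
    huniq _ (A.mul_mem hσ (hR g)) _ (A.mul_mem (hR _) hσ) (1, 0) (by
      rw [RelIso.mul_apply, RelIso.mul_apply, hσ1, haarRightMul_apply, haarRightMul_apply, one_mul,
        one_mul, ← h0])
  have hmul0 : ∀ x g, (σ (x * g, 0)).1 = (σ (x, 0)).1 * (σ (g, 0)).1 := fun x g => by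
    have := DFunLike.congr_fun (hcomm g) (x, 0)
    rw [RelIso.mul_apply, RelIso.mul_apply, h0 x, haarRightMul_apply, haarRightMul_apply] at this
    rw [this]
  have hmul1 : ∀ g, (σ (g, 1)).1 = (σ (1, 1)).1 * (σ (g, 0)).1 := fun g => by
    have := DFunLike.congr_fun (hcomm g) (1, 1)
    rw [RelIso.mul_apply, RelIso.mul_apply, h1 1, haarRightMul_apply, haarRightMul_apply,
      one_mul] at this
    rw [this]
  have hsq : σ * σ = haarRightMul S (σ (1, 1)).1 :=
    huniq _ (A.mul_mem hσ hσ) _ (hR _) (1, 0) (by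
      rw [RelIso.mul_apply, hσ1, haarRightMul_apply, one_mul, ← h1])
  refine ⟨MonoidHom.mk' (fun g => (σ (g, 0)).1) hmul0, (σ (1, 1)).1, ?_, ?_, ?_, ?_⟩
  · intro a b hab
    have hab' : (σ (a, 0)).1 = (σ (b, 0)).1 := hab
    have : σ (a, 0) = σ (b, 0) := by rw [h0 a, h0 b, hab']
    simpa using σ.injective this
  · have := DFunLike.congr_fun hsq (1, 1)
    rw [RelIso.mul_apply, haarRightMul_apply, one_mul, h1 1] at this
    exact (congrArg Prod.fst this :)
  · intro g
    have := DFunLike.congr_fun hsq (g, 0)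
    rw [RelIso.mul_apply, h0 g, haarRightMul_apply] at this
    exact (hmul1 _).symm.trans (congrArg Prod.fst this)
  · intro s hs
    have hadj : (haarGraph S).Adj (1, 0) (s, 1) := by simpa using hs
    rw [← σ.map_adj_iff, hσ1, h1 s, SimpleGraph.adj_comm, haarGraph_adj_zero_one, hmul1 s,
      one_mul] at hadj
    exact hadj

/-- If the Haar graph of `N ∪ {x}` is algebraically Cayley, where `N` is a nontrivial normal
subgroup, then some automorphism of `G` inverts `x` modulo `N`. -/
theorem IsAlgebraicallyCayley.exists_mul_mem {N : Subgroup G} [Finite G] [N.Normal] {x : G}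
    (hx : x ∉ N) (hN : N ≠ ⊥) (hsq : ∀ g : G, g ^ 2 ∈ N → g ∈ N)
    (h : IsAlgebraicallyCayley ((N : Set G) ∪ {x})) :
    ∃ (α : G →* G) (c : G), α c = c ∧ (∀ g, c * α (α g) = g * c) ∧ c ∈ N ∧ α x * x ∈ N := by
  obtain ⟨α, c, hinj, hc, hαα, hS⟩ := h.exists_monoidHom
  have hS' : ∀ s, s ∈ N ∨ s = x → c * α s ∈ N ∨ c * α s = x⁻¹ := by
    intro s hs
    have := hS s (by simpa [or_comm] using hs)
    simp only [Set.union_singleton, Set.mem_insert_iff, SetLike.mem_coe, inv_mem_iff] at this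
    rw [inv_eq_iff_eq_inv] at this
    exact this.symm
  -- If `α n ∉ N`, then `c`, `c * α n` and `c * α n ^ 2` lie in three different cosets of `N`, but
  -- `N ∪ {x⁻¹}` meets only two.
  have hαN : ∀ n ∈ N, α n ∈ N := by
    intro n hn
    by_contra hu
    have hu2 : α n ^ 2 ∉ N := fun h2 => hu (hsq _ h2)
    have e0 := hS' 1 (Or.inl N.one_mem)
    have e1 := hS' n (Or.inl hn)
    have e2 := hS' (n ^ 2) (Or.inl (N.pow_mem hn 2))
    rw [map_one, mul_one] at e0
    rw [map_pow] at e2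
    rcases e0 with e0 | e0
    · rw [N.mul_mem_cancel_left e0] at e1 e2
      have := (e1.resolve_left hu).trans (e2.resolve_left hu2).symm
      rw [mul_right_inj, pow_two, left_eq_mul] at this
      exact hu (this ▸ N.one_mem)
    · rcases e1 with e1 | e1
      · rcases e2 with e2 | e2
        · rw [pow_two, ← mul_assoc, N.mul_mem_cancel_left e1] at e2
          exact hu e2
        · rw [← e0, mul_eq_left] at e2
          exact hu2 (e2 ▸ N.one_mem)
      · rw [← e0, mul_eq_left] at e1
        exact hu (e1 ▸ N.one_mem)
  have hcN : c ∈ N := by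
    by_contra hcN
    obtain ⟨n, hn1⟩ := N.ne_bot_iff_exists_ne_one.1 hN
    have e0 := hS' 1 (Or.inl N.one_mem)
    have e1 := hS' n (Or.inl n.2)
    rw [map_one, mul_one] at e0
    rw [N.mul_mem_cancel_right (hαN _ n.2)] at e1
    have := (e1.resolve_left hcN).trans (e0.resolve_left hcN).symm
    rw [mul_eq_left, map_eq_one_iff α hinj] at this
    exact hn1 (Subtype.ext this)
  refine ⟨α, c, hc, hαα, hcN, ?_⟩
  have hsurj : ∀ n ∈ N, ∃ n' ∈ N, α n' = n := by
    intro n hn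
    obtain ⟨⟨n', h1⟩, h2⟩ := Finite.surjective_of_injective
      (f := fun a : N => (⟨α a, hαN _ a.2⟩ : N))
      (fun a b hab => Subtype.ext (hinj (congrArg Subtype.val hab))) ⟨n, hn⟩
    exact ⟨n', h1, congrArg Subtype.val h2⟩
  have e := hS' x (Or.inr rfl)
  rw [N.mul_mem_cancel_left hcN] at e
  rcases e with e | e
  · obtain ⟨n', h1, h2⟩ := hsurj _ e
    exact absurd (hinj h2 ▸ h1) hx
  · rw [← eq_inv_mul_iff_mul_eq] at e
    rw [e, inv_mul_cancel_right]
    exact N.inv_mem hcN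

/-- The Haar graph of `N ∪ {x}`, where `N` is the kernel of a homomorphism onto a cyclic group,
is a Cayley graph of the product of any group of order `|N|` with a dihedral group. -/
theorem isCayleyGraphOf_haarGraph_union_singleton {p m : ℕ} [NeZero p] [Finite G]
    {N : Subgroup G} (i : G →* Multiplicative (ZMod p)) (hi : Function.Surjective i)
    (hiN : i.ker = N) (hm : Nat.card N = m) {x : G} (hx : x ∉ N) :
    IsCayleyGraphOf (haarGraph ((N : Set G) ∪ {x}))
      (Multiplicative (ZMod m) × DihedralGroup p) := by
  subst hiN
  have hm0 : NeZero m := ⟨by rw [← hm]; exact Nat.card_pos.ne'⟩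
  let u : ZMod p := (i x).toAdd
  -- Reflections `sr 0` with any first coordinate give the complete bipartite graphs; `(1, sr u)`
  -- gives the matching.
  let T : Set (Multiplicative (ZMod m) × DihedralGroup p) :=
    {a | a.2 = .sr 0 ∨ a = (1, .sr u)}
  have hne : ∀ v : ZMod p, (1 : DihedralGroup p) ≠ .sr v := fun v h => by
    rw [DihedralGroup.one_def] at h
    cases h
  have hT1 : (1 : Multiplicative (ZMod m) × DihedralGroup p) ∉ T := by
    rintro (h | h)
    · exact hne _ h
    · exact hne _ (congrArg Prod.snd h)
  have hT : T⁻¹ = T := by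
    ext ⟨a, b⟩
    rw [Set.mem_inv]
    simp only [T, Set.mem_ofPred_eq]
    rw [Prod.snd_inv, inv_eq_iff_eq_inv, inv_eq_iff_eq_inv, Prod.inv_mk, inv_one,
      DihedralGroup.inv_sr, DihedralGroup.inv_sr]
  obtain ⟨e⟩ : Nonempty (i.ker ≃ Multiplicative (ZMod m)) := by
    rw [← Finite.card_eq, hm, Nat.card_congr Multiplicative.toAdd, Nat.card_zmod]
  obtain ⟨s, hs⟩ := hi.hasRightInverse
  let l : G → Multiplicative (ZMod m) := fun g => e ⟨g * (s (i g))⁻¹, by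
    rw [MonoidHom.mem_ker, map_mul, map_inv, hs, mul_inv_cancel]⟩
  have hl : ∀ g h, i g = i h → l g = l h → g = h := by
    intro g h h1 h2
    have h3 : g * (s (i g))⁻¹ = h * (s (i h))⁻¹ := congrArg Subtype.val (e.injective h2)
    rwa [h1, mul_left_inj] at h3
  -- The shift by `x⁻¹` in layer 1 gives matched vertices the same label.
  let F : G × Fin 2 → Multiplicative (ZMod m) × DihedralGroup p := fun a =>
    if a.2 = 0 then (l a.1, .r (i a.1).toAdd) else (l (x⁻¹ * a.1), .sr (i a.1).toAdd)
  have hF0 : ∀ g, F (g, 0) = (l g, .r (i g).toAdd) := fun g => rfl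
  have hF1 : ∀ g, F (g, 1) = (l (x⁻¹ * g), .sr (i g).toAdd) := fun g => rfl
  have hadj : ∀ a b, (cayleyGraph T hT1 hT).Adj a b ↔ b * a⁻¹ ∈ T := by
    intro a b
    constructor
    · rintro ⟨t, ht, rfl⟩
      simpa using ht
    · intro h
      exact ⟨_, h, by simp⟩
  have hnot : ∀ a k, (a, DihedralGroup.r k) ∉ T := by
    rintro a k (h | h)
    · cases h
    · cases congrArg Prod.snd h
  have h01 : ∀ g h, (cayleyGraph T hT1 hT).Adj (F (g, 0)) (F (h, 1)) ↔
      (haarGraph ((i.ker : Set G) ∪ {x})).Adj (g, 0) (h, 1) := by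
    intro g h
    rw [hadj, haarGraph_adj_zero_one, hF0, hF1]
    simp only [T, Set.mem_ofPred_eq, Prod.inv_mk, Prod.mk_mul_mk, DihedralGroup.inv_r,
      DihedralGroup.sr_mul_r, DihedralGroup.sr.injEq, Prod.mk.injEq, Set.mem_union,
      Set.mem_singleton_iff, SetLike.mem_coe, MonoidHom.mem_ker, map_mul, map_inv,
      mul_inv_eq_one, add_neg_eq_zero, EmbeddingLike.apply_eq_iff_eq]
    refine or_congr_right ⟨fun ⟨h1, h2⟩ => ?_, ?_⟩
    · have h3 : i h * (i g)⁻¹ = i x := h2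
      rw [mul_inv_eq_iff_eq_mul, ← inv_mul_eq_iff_eq_mul]
      refine hl _ _ ?_ h1
      rw [map_mul, map_inv, ← h3]
      group
    · intro h1
      rw [mul_inv_eq_iff_eq_mul] at h1
      refine ⟨by rw [h1]; simp, ?_⟩
      rw [h1]
      simp [u]
  have hinj : Function.Injective F := by
    rintro ⟨g, a⟩ ⟨h, b⟩ hgh
    fin_cases a <;> fin_cases b
    · obtain ⟨h1, h2⟩ := Prod.mk.inj hgh
      simp only [DihedralGroup.r.injEq] at h2
      exact Prod.ext (hl _ _ h2 h1) rfl
    · cases congrArg Prod.snd hgh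
    · cases congrArg Prod.snd hgh
    · obtain ⟨h1, h2⟩ := Prod.mk.inj hgh
      simp only [DihedralGroup.sr.injEq, EmbeddingLike.apply_eq_iff_eq] at h2
      exact Prod.ext (mul_left_cancel (hl _ _ (by simp [h2]) h1)) rfl
  have hcard : Nat.card (Multiplicative (ZMod m) × DihedralGroup p) ≤ Nat.card (G × Fin 2) := by
    rw [Nat.card_prod, Nat.card_prod, Nat.card_congr Multiplicative.toAdd, Nat.card_zmod,
      DihedralGroup.nat_card, ← i.ker.card_mul_index, hm, Subgroup.index_ker,
      MonoidHom.range_eq_top.2 hi, Nat.card_congr Subgroup.topEquiv.toEquiv,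
      Nat.card_congr Multiplicative.toAdd, Nat.card_zmod, Nat.card_eq_fintype_card, Fintype.card_fin]
    exact le_of_eq (by ring)
  refine ⟨T, hT1, hT, ⟨⟨Equiv.ofBijective F (hinj.bijective_of_nat_card_le hcard), ?_⟩⟩⟩
  rintro ⟨g, a⟩ ⟨h, b⟩
  simp only [Equiv.ofBijective_apply]
  fin_cases a <;> fin_cases b <;> simp only [Fin.zero_eta, Fin.mk_one]
  · refine iff_of_false ?_ haarGraph_not_adj_same
    rw [hadj, hF0, hF0]
    exact hnot _ _
  · exact h01 g h
  · rw [SimpleGraph.adj_comm, h01, SimpleGraph.adj_comm]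
  · refine iff_of_false ?_ haarGraph_not_adj_same
    rw [hadj, hF1, hF1]
    exact hnot _ _

end HaarGraph

/-! ### The main theorem -/

theorem proposition2p4 (p : ℕ) (hp : p.Prime) (hp2 : p ≠ 2)
    (G : Type*) [Group G] (n : ℕ) (hcard : Nat.card G = p ^ n) (hG : IsNonsplitMetacyclic G)
    (N : Subgroup G) (hN : N.index = p) (x : G) (hx : x ∉ N) :
    IsCayleyGraphOf (haarGraph ((N : Set G) ∪ {x}))
        (Multiplicative (ZMod (p ^ (n - 1))) × DihedralGroup p) ∧
      ¬ IsAlgebraicallyCayley ((N : Set G) ∪ {x}) := by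
  have : Fact p.Prime := ⟨hp⟩
  have hfin : Finite G := Nat.finite_of_card_ne_zero (hcard ▸ (pow_pos hp.pos n).ne')
  have hpG : IsPGroup p G := IsPGroup.of_card hcard
  obtain ⟨n, rfl⟩ : ∃ k, n = k + 1 := by
    refine Nat.exists_eq_succ_of_ne_zero ?_
    rintro rfl
    have h1 : N.index ∣ 1 := by simpa [hcard] using N.index_dvd_card
    rw [hN, Nat.dvd_one] at h1
    exact hp.ne_one h1
  have hNn : N.Normal := Subgroup.normal_of_index_eq_minFac_card (by
    rw [hN, hcard, Nat.pow_minFac n.succ_ne_zero, hp.minFac_eq])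
  have hNcard : Nat.card N = p ^ n := by
    have := N.card_mul_index
    rw [hN, hcard, pow_succ] at this
    exact Nat.eq_of_mul_eq_mul_right hp.pos this
  have hQcard : Nat.card (G ⧸ N) = p := hN
  have hQ : IsCyclic (G ⧸ N) := isCyclic_of_prime_card hQcard
  rw [Nat.add_sub_cancel]
  constructor
  · have : NeZero p := ⟨hp.ne_zero⟩
    let f : (G ⧸ N) ≃* Multiplicative (ZMod p) := hQcard ▸ (zmodCyclicMulEquiv hQ).symm
    refine isCayleyGraphOf_haarGraph_union_singleton
      (f.toMonoidHom.comp (QuotientGroup.mk' N))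
      (f.surjective.comp (QuotientGroup.mk'_surjective N)) ?_ hNcard hx
    ext g
    simp
  · intro hA
    obtain ⟨⟨K, hKn, hK, hGK⟩, hns⟩ := hG
    have hco : p.Coprime 2 := (Nat.coprime_primes hp Nat.prime_two).2 hp2
    have hsq : ∀ g : G, g ^ 2 ∈ N → g ∈ N := by
      intro g hg
      obtain ⟨m, hm⟩ := hpG.exists_pow_pow_eq_self hco g
      exact hm ▸ N.pow_mem hg m
    have hNb : N ≠ ⊥ := by
      rintro rfl
      rw [Subgroup.index_bot] at hN
      have hc : IsCyclic G := isCyclic_of_prime_card hN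
      exact hns ⟨⊤, ⊥, inferInstance, inferInstance, inferInstance,
        Subgroup.isComplement'_top_bot⟩
    obtain ⟨α, c, hc, hαα, hcN, hx2⟩ := hA.exists_mul_mem hx hNb hsq
    apply hns
    -- The power `d = c ^ m` is a square root of `c` fixed by `α`, so conjugation by `d` after `α`
    -- squares to the identity.
    obtain ⟨m, hm⟩ := hpG.exists_pow_pow_eq_self hco c
    have hd2 : c ^ m * c ^ m = c := by
      rw [← pow_add, ← two_mul, pow_mul, hm]
    have hαd : α (c ^ m) = c ^ m := by rw [map_pow, hc]
    have hdN : c ^ m ∈ N := N.pow_mem hcN m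
    generalize c ^ m = d at hd2 hαd hdN
    let _ : CommGroup (G ⧸ K) := IsCyclic.commGroup
    refine hpG.isSplitMetacyclic_of_involutive hp2 (QuotientGroup.mk' K)
      (by rwa [QuotientGroup.ker_mk']) (β := (MulAut.conj d).toMonoidHom.comp α) ?_ ⟨x, ?_⟩
    · intro g
      simp only [MonoidHom.comp_apply, MulEquiv.toMonoidHom_eq_coe, MonoidHom.coe_coe,
        MulAut.conj_apply, map_mul, map_inv, hαd]
      have := hαα g
      rw [← hd2] at this
      calc d * d * d⁻¹ * (d * α (α g) * d⁻¹) * (d * d * d⁻¹)⁻¹ = d * d * α (α g) * (d * d)⁻¹ := by group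
        _ = g := by rw [this]; group
    · simp only [MonoidHom.comp_apply, MulEquiv.toMonoidHom_eq_coe, MonoidHom.coe_coe,
        MulAut.conj_apply]
      intro h
      apply hx
      apply hsq
      -- If `β` fixed `x`, this element would be `x * d * x⁻¹ * x ^ 2`, forcing `x ^ 2 ∈ N`.
      have h1 : d * (α x * x) ∈ N := N.mul_mem hdN hx2
      have h2 : d * (α x * x) = x * d * x⁻¹ * x ^ 2 := by
        calc d * (α x * x) = d * α x * d⁻¹ * (d * x) := by group
          _ = _ := by rw [h, pow_two]; group
      rwa [h2, N.mul_mem_cancel_left (hNn.conj_mem d hdN x)] at h1
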